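/- Let $X_1, X_2, \ldots$ be independent, identically distributed real random variables whose common distribution function is continuous, and let $\mathcal{F}_i = \sigma\{X_1, \ldots, X_i\}$. A feasible (on-line) policy $\pi$ is a sequence of $(\mathcal{F}_i)$-stopping times $\tau_1, \tau_2, \ldots$ with values in $\{1, 2, \ldots\} \cup \{\infty\}$ such that $\tau_k < \tau_{k+1}$ whenever $\tau_{k+1} < \infty$ (so that $\tau_{k+1} = \infty$ whenever $\tau_k = \infty$) and such that the selected values alternate, $X_{\tau_1} < X_{\tau_2} > X_{\tau_3} < X_{\tau_4} > \cdots$, as long as the stopping times are finite. Let $\Pi$ be the set of feasible policies, and for $\pi \in \Pi$ let $A^o_n(\pi)$ be the number of $k$ with $\tau_k \leq n$, i.e. the number of selections that $\pi$ makes up to and including time $n$. For each $n = 1, 2, \ldots$ there is a policy $\pi^*_n \in \Pi$ such that $$\mathbb{E}[A^o_n(\pi^*_n)] = \sup_{\pi \in \Pi} \mathbb{E}[A^o_n(\pi)],$$ and for such an optimal policy one has, for all $n \geq 1$, $$(2 - \sqrt{2})\, n \leq \mathbb{E}[A^o_n(\pi^*_n)] \leq (2 - \sqrt{2})\, n + C,$$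 where $C$ is an absolute constant (independent of $n$ and of the distribution of the $X_i$) with $C < 11 - 4\sqrt{2}$. In particular, $\mathbb{E}[A^o_n(\pi^*_n)] \sim (2 - \sqrt{2})\, n$ as $n \to \infty$. -/

import Mathlib

open MeasureTheory ProbabilityTheory Filter Asymptotics

/-- The increasing sequence of sigma-fields generated by the observations. Observations and times
are numbered from `0`: `X i` is the `(i + 1)`-st observation, and the `i`-th sigma-field is
generated by `X 0, …, X i`, the first `i + 1` observations. -/
noncomputable def observationFiltration {Ω : Type*} [mΩ : MeasurableSpace Ω]
    (X : ℕ → Ω → ℝ) (hX : ∀ i, Measurable (X i)) : Filtration ℕ mΩ :=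
  Filtration.natural X fun i => (hX i).stronglyMeasurable

/-- A feasible policy for the on-line selection of an alternating subsequence of the observations.
`τ k ω` is the time of the `(k + 1)`-st selection, or `⊤` if fewer than `k + 1` selections are
ever made. -/
structure SelectionPolicy {Ω : Type*} [mΩ : MeasurableSpace Ω]
    (X : ℕ → Ω → ℝ) (hX : ∀ i, Measurable (X i)) where
  /-- The selection times. -/
  τ : ℕ → Ω → WithTop ℕ
  /-- Selections are made on-line: each selection time is a stopping time. -/
  isStoppingTime : ∀ k, IsStoppingTime (observationFiltration X hX) (τ k)
  /-- The selection times increase strictly, as long as selections are made; when there is no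
  `(k + 1)`-st selection there is no later one either. -/
  strictly_increasing : ∀ k ω, τ (k + 1) ω ≠ ⊤ → τ k ω < τ (k + 1) ω
  /-- The selected values alternate: first `<`, then `>`, then `<`, and so on. -/
  alternating : ∀ (k : ℕ) (ω : Ω) (i j : ℕ), τ k ω = i → τ (k + 1) ω = j →
    if Even k then X i ω < X j ω else X i ω > X j ω

namespace SelectionPolicy

variable {Ω : Type*} [mΩ : MeasurableSpace Ω] {X : ℕ → Ω → ℝ} {hX : ∀ i, Measurable (X i)}

/-- The number of selections that the policy makes among the first `n` observations
`X 0, …, X (n - 1)`. -/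
noncomputable def numSelected (π : SelectionPolicy X hX) (n : ℕ) (ω : Ω) : ℕ :=
  Set.ncard {k : ℕ | π.τ k ω < n}

/-- The expected number of selections among the first `n` observations. -/
noncomputable def expectedSelected (P : Measure Ω) (π : SelectionPolicy X hX) (n : ℕ) : ℝ :=
  ∫ ω, (π.numSelected n ω : ℝ) ∂P

/-- The policy maximizes, over all feasible policies, the expected number of selections among the
first `n` observations. -/
def IsOptimal (P : Measure Ω) (π : SelectionPolicy X hX) (n : ℕ) : Prop :=
  IsGreatest (Set.range fun π' : SelectionPolicy X hX => expectedSelected P π' n)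
    (expectedSelected P π n)

theorem le_time (π : SelectionPolicy X hX) (k : ℕ) (ω : Ω) : (k : WithTop ℕ) ≤ π.τ k ω := by
  induction k with
  | zero => simp
  | succ k ih =>
    by_cases h : π.τ (k + 1) ω = ⊤
    · simp [h]
    · have h1 := lt_of_le_of_lt ih (π.strictly_increasing k ω h)
      obtain ⟨m, hm⟩ := WithTop.ne_top_iff_exists.mp h
      rw [← hm] at h1 ⊢
      exact WithTop.coe_le_coe.mpr (Nat.succ_le_of_lt (WithTop.coe_lt_coe.mp h1))

/-- Only indices below `n` are counted; in particular the set that is counted is finite. -/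
theorem numSelected_eq_sum (π : SelectionPolicy X hX) (n : ℕ) (ω : Ω) :
    (π.numSelected n ω : ℝ) =
      ∑ k ∈ Finset.range n, Set.indicator {ω | π.τ k ω < n} (fun _ => (1 : ℝ)) ω := by
  classical
  have h : {k : ℕ | π.τ k ω < n} = ((Finset.range n).filter fun k => π.τ k ω < n : Finset ℕ) := by
    ext k
    simp only [Set.mem_ofPred_eq, Finset.coe_filter, Finset.mem_range]
    refine ⟨fun hk => ⟨?_, hk⟩, fun hk => hk.2⟩
    exact_mod_cast lt_of_le_of_lt (π.le_time k ω) hk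
  unfold numSelected
  rw [h, Set.ncard_coe_finset]
  simp [Set.indicator_apply]

/-- The number of selections is integrable, so its expectation is a genuine one. -/
theorem integrable_numSelected (P : Measure Ω) [IsFiniteMeasure P] (π : SelectionPolicy X hX)
    (n : ℕ) : Integrable (fun ω => (π.numSelected n ω : ℝ)) P := by
  simp_rw [numSelected_eq_sum]
  refine integrable_finsetSum _ fun k _ => ?_
  refine (integrable_const (1 : ℝ)).indicator ?_
  exact (observationFiltration X hX).le n _ ((π.isStoppingTime k).measurableSet_lt n)

end SelectionPolicy

/-!
Ranks reduce the problem to uniform observations: the law `μ` of `X 0` has no atoms, so `cdf μ (X i)`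
is uniform on `[0, 1]` (`map_cdf_eq_volume_restrict`). Reflecting ranks by `u ↦ 1 - u` at every
other selection makes every selection an upward move, and the history matters only through a level
`y`: the next oriented rank `u` can be selected if it exceeds `y`, and the level then becomes
`1 - u`. With `k` observations left the optimal value is `selectionValue k y`, defined by the
Bellman recursion
`v (k + 1) y = y * v k y + ∫ x in y..1, max (v k y) (1 + v k (1 - x))`.

The optimal expected number of selections is `selectionValue n 0`. Along any policy the number of
selections made so far plus the value of the current level is a supermartingale
(`SelectionPolicy.expectedSelected_le`), and it is a martingale for the policy that selects whenever
this is feasible and worthwhile (`expectedSelected_greedyPolicy`). The distribution function is only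
weakly monotone, so an arbitrary policy is known to respect the levels with `≤` whereas the
constructed one respects them with `<`; both lead to the same integrals (`bellmanGain`).

It remains to compare `selectionValue k` with `k ↦ 2 ξ k + h`, where `ξ = 1 - √2 / 2` and `h` solves
the average-reward equation `2 ξ + h y = y * h y + ∫ x in y..1, max (h y) (1 + h (1 - x))`.
Differentiating that equation and using the symmetry `y ↦ 1 - y` gives `h` in closed form on
`[ξ, 1 - ξ]` (`relativeValueCore`); there it decreases from `0` to `-1`. Continued by the constants
`0` and `-1`, it still solves the equation up to `1 - ξ`, and it is a supersolution above. Hence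
`2 ξ k + h y ≤ selectionValue k y` for `y ≤ 1 - ξ` (`le_selectionValue`), and
`selectionValue k y ≤ 2 ξ k + 1 + h y` (`selectionValue_le`). As `h 0 = 0`, this yields the two bounds,
with `C = 1`.
-/

/-! ### The average-reward equation -/

/-- The limiting selection threshold `ξ = 1 - √2 / 2`; it solves `ξ ^ 2 - 2 ξ + 1 / 2 = 0`. -/
noncomputable def limitThreshold : ℝ := 1 - Real.sqrt 2 / 2

local notation "ξ" => limitThreshold

theorem limitThreshold_quadratic : ξ ^ 2 - 2 * ξ + 1 / 2 = 0 := by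
  have h : Real.sqrt 2 ^ 2 = 2 := Real.sq_sqrt (by norm_num)
  unfold limitThreshold
  linear_combination h / 4

theorem two_mul_limitThreshold : 2 * ξ = 2 - Real.sqrt 2 := by
  unfold limitThreshold
  ring

theorem limitThreshold_pos : 0 < ξ := by
  have h : Real.sqrt 2 < 2 := by rw [Real.sqrt_lt' (by norm_num)]; norm_num
  unfold limitThreshold
  linarith

theorem limitThreshold_lt_half : ξ < 1 / 2 := by
  have h : (1 : ℝ) < Real.sqrt 2 := by rw [Real.lt_sqrt (by norm_num)]; norm_num
  unfold limitThreshold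
  linarith

/-- The solution, on the interval `[ξ, 1 - ξ]`, of the average-reward equation
`2 ξ + p y = y * p y + ∫ x in y..1, (1 + p (1 - x))` with `p = 0` below `ξ`. -/
noncomputable def relativeValueCore (y : ℝ) : ℝ :=
  (Real.log y + Real.log (1 - y) - Real.log ξ - Real.log (1 - ξ)
    - (1 - y)⁻¹ + (1 - ξ)⁻¹) / 2

theorem relativeValueCore_threshold : relativeValueCore ξ = 0 := by
  unfold relativeValueCore
  ring

theorem relativeValueCore_one_sub_threshold : relativeValueCore (1 - ξ) = -1 := by
  have h0 := limitThreshold_pos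
  have h1 : 0 < 1 - ξ := by linarith [limitThreshold_lt_half]
  have h2 := limitThreshold_quadratic
  unfold relativeValueCore
  rw [sub_sub_cancel]
  field_simp
  linear_combination -2 * h2

theorem hasDerivAt_relativeValueCore {y : ℝ} (h0 : 0 < y) (h1 : y < 1) :
    HasDerivAt relativeValueCore ((y⁻¹ - (1 - y)⁻¹ - ((1 - y) ^ 2)⁻¹) / 2) y := by
  have h1' : 1 - y ≠ 0 := by linarith
  have hsub : HasDerivAt (fun y : ℝ => 1 - y) (-1) y := by
    simpa using (hasDerivAt_id y).const_sub 1
  have := (((((((Real.hasDerivAt_log h0.ne').add (hsub.log h1')).sub_const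
    (Real.log ξ)).sub_const (Real.log (1 - ξ))).sub (hsub.inv h1')).add_const
    (1 - ξ)⁻¹).div_const 2)
  refine this.congr_deriv ?_
  field_simp
  ring

theorem antitoneOn_relativeValueCore : AntitoneOn relativeValueCore (Set.Icc ξ (1 - ξ)) := by
  have hpos := limitThreshold_pos
  have hd : ∀ y ∈ Set.Icc ξ (1 - ξ), HasDerivAt relativeValueCore
      ((y⁻¹ - (1 - y)⁻¹ - ((1 - y) ^ 2)⁻¹) / 2) y := fun y hy =>
    hasDerivAt_relativeValueCore (by linarith [hy.1]) (by linarith [hy.2])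
  refine antitoneOn_of_deriv_nonpos (convex_Icc _ _)
    (fun y hy => (hd y hy).continuousAt.continuousWithinAt)
    (fun y hy => (hd y (interior_subset hy)).differentiableAt.differentiableWithinAt) ?_
  intro y hy
  have hy := interior_subset hy
  rw [(hd y hy).deriv]
  have h0 : 0 < y := by linarith [hy.1]
  have h1 : 0 < 1 - y := by linarith [hy.2]
  have hq := limitThreshold_quadratic
  -- The roots of the quadratic are `ξ` and `2 - ξ`.
  have hle : y ^ 2 - 2 * y + 1 / 2 ≤ 0 := by nlinarith [hy.1, hy.2]
  have heq : (y⁻¹ - (1 - y)⁻¹ - ((1 - y) ^ 2)⁻¹) / 2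
      = (y ^ 2 - 2 * y + 1 / 2) / (y * (1 - y) ^ 2) := by
    field_simp
    ring
  rw [heq]
  exact div_nonpos_of_nonpos_of_nonneg hle (by positivity)

/-- The relative value function of the average-reward problem, truncated below at `-1`: it
vanishes on `[0, ξ]`, and is constantly `-1` on `[1 - ξ, 1]`. -/
noncomputable def relativeValue (y : ℝ) : ℝ := relativeValueCore (max ξ (min y (1 - ξ)))

theorem clamp_mem (y : ℝ) : max ξ (min y (1 - ξ)) ∈ Set.Icc ξ (1 - ξ) :=
  ⟨le_max_left _ _, max_le (by linarith [limitThreshold_lt_half]) (min_le_right _ _)⟩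

theorem relativeValue_of_le {y : ℝ} (h : y ≤ ξ) : relativeValue y = 0 := by
  have := limitThreshold_lt_half
  rw [relativeValue, min_eq_left (by linarith), max_eq_left h, relativeValueCore_threshold]

theorem relativeValue_of_ge {y : ℝ} (h : 1 - ξ ≤ y) : relativeValue y = -1 := by
  have := limitThreshold_lt_half
  rw [relativeValue, min_eq_right h, max_eq_right (by linarith),
    relativeValueCore_one_sub_threshold]

theorem relativeValue_of_mem {y : ℝ} (h : y ∈ Set.Icc ξ (1 - ξ)) :
    relativeValue y = relativeValueCore y := by
  rw [relativeValue, min_eq_left h.2, max_eq_right h.1]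

theorem relativeValue_nonpos (y : ℝ) : relativeValue y ≤ 0 := by
  rw [← relativeValueCore_threshold]
  exact antitoneOn_relativeValueCore
    ⟨le_rfl, by linarith [limitThreshold_lt_half]⟩ (clamp_mem y) (clamp_mem y).1

theorem neg_one_le_relativeValue (y : ℝ) : -1 ≤ relativeValue y := by
  rw [← relativeValueCore_one_sub_threshold]
  exact antitoneOn_relativeValueCore (clamp_mem y)
    ⟨by linarith [limitThreshold_lt_half], le_rfl⟩ (clamp_mem y).2

theorem continuous_relativeValue : Continuous relativeValue := by
  refine continuous_iff_continuousAt.2 fun y => ?_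
  have h := clamp_mem y
  have hpos := limitThreshold_pos
  have hc : Continuous fun y : ℝ => max ξ (min y (1 - ξ)) := by fun_prop
  exact ContinuousAt.comp (f := fun y : ℝ => max ξ (min y (1 - ξ)))
    (hasDerivAt_relativeValueCore (by linarith [h.1]) (by linarith [h.2])).continuousAt
    hc.continuousAt

/-- The primitive of the core comes from the delay equation
`(t * p (1 - t))' = p t + 1`, which `p` satisfies because of the symmetry `t ↦ 1 - t`. -/
theorem integral_relativeValueCore {t : ℝ} (ht : t ∈ Set.Icc ξ (1 - ξ)) :
    ∫ u in ξ..t, relativeValueCore u = t * relativeValueCore (1 - t) - t + 2 * ξ := by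
  have hpos := limitThreshold_pos
  have hsub : ∀ u ∈ Set.uIcc ξ t, 0 < u ∧ u < 1 := by
    intro u hu
    rw [Set.uIcc_of_le ht.1] at hu
    exact ⟨by linarith [hu.1], by linarith [hu.2, ht.2]⟩
  have key : ∀ u ∈ Set.uIcc ξ t,
      HasDerivAt (fun u => u * relativeValueCore (1 - u) - u) (relativeValueCore u) u := by
    intro u hu
    obtain ⟨h0, h1⟩ := hsub u hu
    have hs : HasDerivAt (fun y : ℝ => 1 - y) (-1) u := by
      simpa using (hasDerivAt_id u).const_sub 1
    have hp := (hasDerivAt_relativeValueCore (y := 1 - u) (by linarith) (by linarith)).comp u hs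
    refine (((hasDerivAt_id u).mul hp).sub (hasDerivAt_id u)).congr_deriv ?_
    have h1' : 1 - u ≠ 0 := by linarith
    simp only [relativeValueCore, id, Function.comp, sub_sub_cancel]
    field_simp
    ring
  rw [intervalIntegral.integral_eq_sub_of_hasDerivAt key]
  · rw [relativeValueCore_one_sub_threshold]
    ring
  · refine ContinuousOn.intervalIntegrable fun u hu => ?_
    obtain ⟨h0, h1⟩ := hsub u hu
    exact (hasDerivAt_relativeValueCore h0 h1).continuousAt.continuousWithinAt

/-- The average-reward equation for the truncated relative value function, which survives the
truncation for `y ≤ 1 - ξ`. -/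
theorem integral_one_add_relativeValue {y : ℝ} (h1 : y ≤ 1 - ξ) :
    ∫ x in y..1, (1 + relativeValue (1 - x)) = (1 - y) * relativeValue y + 2 * ξ := by
  have hpos := limitThreshold_pos
  have hhalf := limitThreshold_lt_half
  have hint : ∀ a b : ℝ, IntervalIntegrable (fun u => 1 + relativeValue u) volume a b :=
    fun a b => (continuous_const.add continuous_relativeValue).intervalIntegrable a b
  have hlow : ∫ u in (0 : ℝ)..ξ, (1 + relativeValue u) = ξ := by
    rw [intervalIntegral.integral_congr (g := fun _ => (1 : ℝ))]
    · simp
    · intro u hu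
      rw [Set.uIcc_of_le hpos.le] at hu
      simp [relativeValue_of_le hu.2]
  have hmid : ∀ t ∈ Set.Icc ξ (1 - ξ),
      ∫ u in (0 : ℝ)..t, (1 + relativeValue u) = t * relativeValueCore (1 - t) + 2 * ξ := by
    intro t ht
    rw [← intervalIntegral.integral_add_adjacent_intervals (hint 0 ξ) (hint ξ t), hlow,
      intervalIntegral.integral_add (by simp) (continuous_relativeValue.intervalIntegrable _ _),
      intervalIntegral.integral_congr (f := relativeValue) (g := relativeValueCore),
      integral_relativeValueCore ht]
    · simp
      ring
    · intro u hu
      rw [Set.uIcc_of_le ht.1] at hu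
      exact relativeValue_of_mem ⟨hu.1, hu.2.trans ht.2⟩
  rw [intervalIntegral.integral_comp_sub_left (fun u => 1 + relativeValue u) 1, sub_self]
  rcases le_total ξ y with hy | hy
  · rw [hmid _ ⟨by linarith, by linarith⟩, relativeValue_of_mem ⟨hy, h1⟩, sub_sub_cancel]
  · rw [← intervalIntegral.integral_add_adjacent_intervals (hint 0 (1 - ξ)) (hint _ _),
      hmid _ ⟨by linarith, le_rfl⟩, sub_sub_cancel, relativeValueCore_threshold,
      relativeValue_of_le hy, intervalIntegral.integral_congr (g := fun _ => (0 : ℝ))]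
    · simp
    · intro u hu
      rw [Set.uIcc_of_le (by linarith)] at hu
      simp [relativeValue_of_ge hu.1]

/-! ### The value function -/

/-- The value function of the selection problem for uniform observations: `selectionValue k y` is
the largest expected number of further selections from `k` observations when, after reflecting
`x ↦ 1 - x` if need be, the next selection has to exceed `y`. A selection of `x` turns the state
`y` into `1 - x`. -/
noncomputable def selectionValue : ℕ → ℝ → ℝ
  | 0, _ => 0
  | k + 1, y => y * selectionValue k y +
      ∫ x in y..1, max (selectionValue k y) (1 + selectionValue k (1 - x))

theorem continuous_selectionValue (k : ℕ) : Continuous (selectionValue k) := by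
  induction k with
  | zero => exact continuous_const
  | succ k ih =>
    have h : Continuous fun y : ℝ =>
        ∫ x in (1 : ℝ)..y, max (selectionValue k y) (1 + selectionValue k (1 - x)) :=
      intervalIntegral.continuous_parametric_intervalIntegral_of_continuous
        (f := fun y x : ℝ => max (selectionValue k y) (1 + selectionValue k (1 - x)))
        (by simp only [Function.uncurry_def]; fun_prop) continuous_id
    have heq : selectionValue (k + 1) = fun y => y * selectionValue k y -
        ∫ x in (1 : ℝ)..y, max (selectionValue k y) (1 + selectionValue k (1 - x)) := by
      funext y
      rw [selectionValue, intervalIntegral.integral_symm, sub_eq_add_neg]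
    rw [heq]
    exact (continuous_id.mul ih).sub h

theorem intervalIntegrable_bellman (k : ℕ) (y a b : ℝ) : IntervalIntegrable
    (fun x => max (selectionValue k y) (1 + selectionValue k (1 - x))) volume a b := by
  have := continuous_selectionValue k
  exact Continuous.intervalIntegrable (by fun_prop) _ _

/-- `k ↦ 2 ξ k + 1 + relativeValue` is a supersolution of the Bellman equation. -/
theorem selectionValue_le (k : ℕ) {y : ℝ} (hy : y ∈ Set.Icc (0 : ℝ) 1) :
    selectionValue k y ≤ 2 * ξ * k + 1 + relativeValue y := by
  induction k generalizing y with
  | zero =>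
    simp only [selectionValue, Nat.cast_zero]
    linarith [neg_one_le_relativeValue y]
  | succ k ih =>
    have hpos := limitThreshold_pos
    have hhalf := limitThreshold_lt_half
    have hc := continuous_relativeValue
    have hmul := mul_le_mul_of_nonneg_left (ih hy) hy.1
    rw [selectionValue]
    push_cast
    rcases le_total y (1 - ξ) with h | h
    · have hint : ∫ x in y..1, max (selectionValue k y) (1 + selectionValue k (1 - x)) ≤
          ∫ x in y..1, (2 * ξ * k + 1 + (1 + relativeValue (1 - x))) := by
        refine intervalIntegral.integral_mono_on hy.2 (intervalIntegrable_bellman _ _ _ _)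
          (Continuous.intervalIntegrable (by fun_prop) _ _) fun x hx => max_le ?_ ?_
        · linarith [ih hy, relativeValue_nonpos y, neg_one_le_relativeValue (1 - x)]
        · linarith [ih (y := 1 - x) ⟨by linarith [hx.2], by linarith [hx.1, hy.1]⟩]
      rw [intervalIntegral.integral_add (by simp)
        (Continuous.intervalIntegrable (by fun_prop) _ _),
        integral_one_add_relativeValue h] at hint
      simp only [intervalIntegral.integral_const, smul_eq_mul] at hint
      linarith
    · -- Counting every available observation as a gain of `1` is enough: `1 - 2 y ≤ 2 ξ - 1`.
      have hint : ∫ x in y..1, max (selectionValue k y) (1 + selectionValue k (1 - x)) ≤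
          ∫ x in y..1, (2 * ξ * k + 2) := by
        refine intervalIntegral.integral_mono_on hy.2 (intervalIntegrable_bellman _ _ _ _)
          (by simp) fun x hx => max_le ?_ ?_
        · linarith [ih hy, relativeValue_nonpos y]
        · linarith [ih (y := 1 - x) ⟨by linarith [hx.2], by linarith [hx.1, hy.1]⟩,
            relativeValue_nonpos (1 - x)]
      simp only [intervalIntegral.integral_const, smul_eq_mul] at hint
      rw [relativeValue_of_ge h] at hmul ⊢
      linarith

/-- `k ↦ 2 ξ k + relativeValue` is a subsolution of the Bellman equation on `[0, 1 - ξ]`; this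
interval is never left by the policy that rejects everything below `ξ`. -/
theorem le_selectionValue (k : ℕ) {y : ℝ} (hy : y ∈ Set.Icc (0 : ℝ) (1 - ξ)) :
    2 * ξ * k + relativeValue y ≤ selectionValue k y := by
  induction k generalizing y with
  | zero => simpa [selectionValue] using relativeValue_nonpos y
  | succ k ih =>
    have hpos := limitThreshold_pos
    have hhalf := limitThreshold_lt_half
    have hc := continuous_relativeValue
    have hmul := mul_le_mul_of_nonneg_left (ih hy) hy.1
    rw [selectionValue]
    push_cast
    have hint : ∫ x in y..1, (2 * ξ * k + (1 + relativeValue (1 - x))) ≤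
        ∫ x in y..1, max (selectionValue k y) (1 + selectionValue k (1 - x)) := by
      refine intervalIntegral.integral_mono_on (by linarith [hy.2])
        (Continuous.intervalIntegrable (by fun_prop) _ _)
        (intervalIntegrable_bellman _ _ _ _) fun x hx => ?_
      -- Below `ξ`, where `relativeValue (1 - x) = -1`, rejecting is as good as the bound requires.
      rcases le_total ξ x with h | h
      · refine le_max_of_le_right ?_
        linarith [ih (y := 1 - x) ⟨by linarith [hx.2], by linarith⟩]
      · refine le_max_of_le_left ?_
        have h1 := ih hy
        rw [relativeValue_of_le (hx.1.trans h)] at h1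
        rw [relativeValue_of_ge (by linarith)]
        linarith
    rw [intervalIntegral.integral_add (by simp)
      (Continuous.intervalIntegrable (by fun_prop) _ _),
      integral_one_add_relativeValue hy.2] at hint
    simp only [intervalIntegral.integral_const, smul_eq_mul] at hint
    linarith

/-! ### The probability integral transform -/

theorem continuous_cdf_of_nullSingleton (μ : Measure ℝ) [IsProbabilityMeasure μ]
    [NullSingletonClass μ] : Continuous (cdf μ) := by
  refine continuous_iff_continuousAt.2 fun x => ?_
  have h := (cdf μ).measure_singleton x
  rw [measure_cdf, measure_singleton, eq_comm, ENNReal.ofReal_eq_zero] at h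
  rw [(monotone_cdf μ).continuousAt_iff_leftLim_eq_rightLim, StieltjesFunction.rightLim_eq]
  exact le_antisymm ((monotone_cdf μ).leftLim_le le_rfl) (by linarith)

/-- The distribution function of an atomless law transforms that law into the uniform law. -/
theorem map_cdf_eq_volume_restrict (μ : Measure ℝ) [IsProbabilityMeasure μ]
    [NullSingletonClass μ] : μ.map (cdf μ) = volume.restrict (Set.Icc 0 1) := by
  have hcont := continuous_cdf_of_nullSingleton μ
  have hmono := monotone_cdf μ
  have hsurj : ∀ b ∈ Set.Ioo (0 : ℝ) 1, ∃ x, cdf μ x = b := by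
    intro b hb
    obtain ⟨x, hx⟩ := ((tendsto_cdf_atBot μ).eventually_lt_const hb.1).exists
    obtain ⟨y, hy⟩ := ((tendsto_cdf_atTop μ).eventually_const_lt hb.2).exists
    exact mem_range_of_exists_le_of_exists_ge hcont ⟨x, hx.le⟩ ⟨y, hy.le⟩
  have hlt : ∀ b ∈ Set.Ioo (0 : ℝ) 1, μ (cdf μ ⁻¹' Set.Iio b) ≤ ENNReal.ofReal b := by
    intro b hb
    obtain ⟨x, hx⟩ := hsurj b hb
    rw [← hx, ofReal_cdf]
    exact measure_mono fun z hz => (hmono.reflect_lt hz).le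
  have hle : ∀ b ∈ Set.Ioo (0 : ℝ) 1, ENNReal.ofReal b ≤ μ (cdf μ ⁻¹' Set.Iic b) := by
    intro b hb
    obtain ⟨x, hx⟩ := hsurj b hb
    rw [← hx, ofReal_cdf]
    exact measure_mono fun z hz => hmono hz
  have : IsProbabilityMeasure (μ.map (cdf μ)) :=
    Measure.isProbabilityMeasure_map hcont.aemeasurable
  refine Measure.ext_of_Iic _ _ fun a => ?_
  rw [Measure.map_apply hcont.measurable measurableSet_Iic,
    Measure.restrict_apply measurableSet_Iic]
  rcases lt_or_ge a 0 with ha | ha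
  · have h1 : cdf μ ⁻¹' Set.Iic a = ∅ :=
      Set.eq_empty_of_forall_notMem fun z hz => absurd (cdf_nonneg μ z) (by
        have : cdf μ z ≤ a := hz
        linarith)
    have h2 : Set.Iic a ∩ Set.Icc 0 1 = ∅ :=
      Set.eq_empty_of_forall_notMem fun z hz => by
        have h3 : z ≤ a := hz.1
        linarith [hz.2.1]
    simp [h1, h2]
  rcases lt_or_ge a 1 with ha1 | ha1
  · have h2 : Set.Iic a ∩ Set.Icc 0 1 = Set.Icc 0 a := by
      ext z
      simp only [Set.mem_inter_iff, Set.mem_Iic, Set.mem_Icc]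
      exact ⟨fun h => ⟨h.2.1, h.1⟩, fun h => ⟨h.2, h.1, h.2.trans ha1.le⟩⟩
    rw [h2, Real.volume_Icc, sub_zero]
    apply le_antisymm
    · refine ge_of_tendsto (x := nhdsWithin a (Set.Ioi a)) (f := ENNReal.ofReal)
        (ENNReal.continuous_ofReal.continuousWithinAt.tendsto) ?_
      filter_upwards [Ioo_mem_nhdsGT ha1] with b hb
      exact (measure_mono fun z (hz : cdf μ z ≤ a) => lt_of_le_of_lt hz hb.1).trans
        (hlt b ⟨ha.trans_lt hb.1, hb.2⟩)
    · rcases ha.eq_or_lt with rfl | h0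
      · simp
      · exact hle a ⟨h0, ha1⟩
  · have h1 : cdf μ ⁻¹' Set.Iic a = Set.univ :=
      Set.eq_univ_of_forall fun z => (cdf_le_one μ z).trans ha1
    have h2 : Set.Iic a ∩ Set.Icc 0 1 = Set.Icc 0 1 :=
      Set.inter_eq_right.2 fun z hz => hz.2.trans ha1
    simp [h1, h2]

/-! ### One observation -/

/-- The reflection that makes every selection an upward move: after an even number of selections
the next one must go down, and a value `u` is replaced by `1 - u`. -/
noncomputable def orient (k : ℕ) (u : ℝ) : ℝ := if Even k then 1 - u else u

theorem orient_mem (k : ℕ) {u : ℝ} (hu : u ∈ Set.Icc (0 : ℝ) 1) :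
    orient k u ∈ Set.Icc (0 : ℝ) 1 := by
  unfold orient
  split_ifs
  · exact ⟨by linarith [hu.2], by linarith [hu.1]⟩
  · exact hu

theorem measurable_orient (k : ℕ) : Measurable (orient k) := by
  unfold orient
  split_ifs <;> fun_prop

theorem cdf_mem_Icc (μ : Measure ℝ) (x : ℝ) : cdf μ x ∈ Set.Icc (0 : ℝ) 1 :=
  ⟨cdf_nonneg μ x, cdf_le_one μ x⟩

theorem integral_orient_cdf (μ : Measure ℝ) [IsProbabilityMeasure μ] [NullSingletonClass μ]
    (k : ℕ) {g : ℝ → ℝ} (hg : Measurable g) :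
    ∫ x, g (orient k (cdf μ x)) ∂μ = ∫ u in (0 : ℝ)..1, g u := by
  have hF := (continuous_cdf_of_nullSingleton μ).measurable
  have h := integral_map (μ := μ) hF.aemeasurable (f := fun u => g (orient k u))
    (hg.comp (measurable_orient k)).aestronglyMeasurable
  rw [← h, map_cdf_eq_volume_restrict, integral_Icc_eq_integral_Ioc,
    ← intervalIntegral.integral_of_le zero_le_one]
  unfold orient
  split_ifs
  · simp [intervalIntegral.integral_comp_sub_left]
  · rfl

/-- The sigma-field generated by the observations strictly before time `i`. -/
@[reducible]
def pastSigma {Ω : Type*} (X : ℕ → Ω → ℝ) (i : ℕ) : MeasurableSpace Ω :=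
  ⨆ j < i, MeasurableSpace.comap (X j) inferInstance


theorem pastSigma_succ {Ω : Type*} [mΩ : MeasurableSpace Ω] {X : ℕ → Ω → ℝ}
    (hX : ∀ i, Measurable (X i)) (i : ℕ) :
    pastSigma X (i + 1) = observationFiltration X hX i := by
  change (⨆ j < i + 1, MeasurableSpace.comap (X j) inferInstance) =
    ⨆ j ≤ i, MeasurableSpace.comap (X j) inferInstance
  simp_rw [Nat.lt_succ_iff]

theorem pastSigma_le {Ω : Type*} [mΩ : MeasurableSpace Ω] {X : ℕ → Ω → ℝ}
    (hX : ∀ i, Measurable (X i)) (i : ℕ) : pastSigma X i ≤ mΩ :=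
  iSup₂_le fun j _ => (hX j).comap_le

theorem pastSigma_mono {Ω : Type*} {X : ℕ → Ω → ℝ}
    : Monotone (pastSigma X) := fun _ _ hij =>
  biSup_mono fun _ h => lt_of_lt_of_le h hij

theorem measurable_pastSigma_succ {Ω : Type*} {X : ℕ → Ω → ℝ}
    (i : ℕ) : Measurable[pastSigma X (i + 1)] (X i) :=
  measurable_iff_comap_le.2
    (le_iSup₂_of_le (f := fun j (_ : j < i + 1) => MeasurableSpace.comap (X j) inferInstance)
      i (Nat.lt_succ_self i) le_rfl)

theorem indep_pastSigma {Ω : Type*} [mΩ : MeasurableSpace Ω] {P : Measure Ω} {X : ℕ → Ω → ℝ}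
    (hX : ∀ i, Measurable (X i)) (hind : iIndepFun X P) (i : ℕ) :
    Indep (pastSigma X i) (MeasurableSpace.comap (X i) inferInstance) P := by
  suffices Indep (⨆ j ∈ {j | j < i}, MeasurableSpace.comap (X j) inferInstance)
      (⨆ j ∈ ({i} : Set ℕ), MeasurableSpace.comap (X j) inferInstance) P by
    rwa [iSup_singleton] at this
  exact indep_iSup_of_disjoint (fun j => (hX j).comap_le) hind (by simp)

/-- Integrating out the next observation, whose oriented rank is uniform given the past. -/
theorem integral_orient_of_past {Ω : Type*} [mΩ : MeasurableSpace Ω] {P : Measure Ω} {X : ℕ → Ω → ℝ}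
    [IsProbabilityMeasure P] (hX : ∀ i, Measurable (X i))
    (hind : iIndepFun X P) (hid : ∀ i, IdentDistrib (X i) (X 0) P P)
    (hna : NullSingletonClass (P.map (X 0))) (i : ℕ) {Z : Ω → ℕ × ℝ}
    (hZ : Measurable[pastSigma X i] Z) (hZI : ∀ ω, (Z ω).2 ∈ Set.Icc (0 : ℝ) 1)
    {g : ℝ → ℝ → ℝ} (hg : Measurable fun p : ℝ × ℝ => g p.1 p.2) {B : ℝ}
    (hB : ∀ y ∈ Set.Icc (0 : ℝ) 1, ∀ u ∈ Set.Icc (0 : ℝ) 1, |g y u| ≤ B) :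
    Integrable (fun ω => g (Z ω).2 (orient (Z ω).1 (cdf (P.map (X 0)) (X i ω)))) P ∧
    ∫ ω, g (Z ω).2 (orient (Z ω).1 (cdf (P.map (X 0)) (X i ω))) ∂P =
      ∫ ω, (∫ u in (0 : ℝ)..1, g (Z ω).2 u) ∂P := by
  set μ := P.map (X 0) with hμ
  have : IsProbabilityMeasure μ := Measure.isProbabilityMeasure_map (hX 0).aemeasurable
  have hF := (continuous_cdf_of_nullSingleton μ).measurable
  have hZm : Measurable Z := hZ.mono (pastSigma_le hX i) le_rfl
  have hindep : IndepFun Z (X i) P :=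
    indep_of_indep_of_le_left (indep_pastSigma hX hind i) hZ.comap_le
  have hmap := hindep.map_prod_eq_prod_map_map hZm.aemeasurable (hX i).aemeasurable
  rw [(hid i).map_eq] at hmap
  have ho : Measurable fun p : (ℕ × ℝ) × ℝ => orient p.1.1 (cdf μ p.2) := by
    have h : Measurable fun q : ℕ × ℝ => orient q.1 q.2 :=
      measurable_from_prod_countable_right measurable_orient
    exact h.comp (f := fun p : (ℕ × ℝ) × ℝ => (p.1.1, cdf μ p.2)) (by fun_prop)
  have hG : Measurable fun p : (ℕ × ℝ) × ℝ => g p.1.2 (orient p.1.1 (cdf μ p.2)) :=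
    hg.comp ((measurable_snd.comp measurable_fst).prodMk ho)
  have hint : Integrable (fun ω => g (Z ω).2 (orient (Z ω).1 (cdf μ (X i ω)))) P :=
    Integrable.of_bound (hG.comp (hZm.prodMk (hX i))).aestronglyMeasurable B
      (ae_of_all _ fun ω => hB _ (hZI ω) _ (orient_mem _ (cdf_mem_Icc μ _)))
  refine ⟨hint, ?_⟩
  have hpair := (hZm.prodMk (hX i)).aemeasurable (μ := P)
  have h1 := integral_map hpair hG.aestronglyMeasurable
  have hint' := (integrable_map_measure hG.aestronglyMeasurable hpair).2 hint
  have : IsProbabilityMeasure (P.map Z) := Measure.isProbabilityMeasure_map hZm.aemeasurable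
  rw [hmap] at h1 hint'
  rw [← h1, integral_prod _ hint', integral_map hZm.aemeasurable
    hint'.integral_prod_left.aestronglyMeasurable]
  refine integral_congr_ae (ae_of_all _ fun ω => ?_)
  exact integral_orient_cdf μ (Z ω).1 (g := g (Z ω).2)
    (hg.comp (measurable_const.prodMk measurable_id))

/-! ### The Bellman operator on one observation -/

open Classical in
/-- The value of the state `y` with `k + 1` observations left, once the first of these turns out
to be `u`. The relation `R` says which observations are available: `R y u` is `y < u` or `y ≤ u`,
and the choice does not affect integrals over `u`. -/
noncomputable def bellmanGain (R : ℝ → ℝ → Prop) (k : ℕ) (y u : ℝ) : ℝ :=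
  if R y u then max (selectionValue k y) (1 + selectionValue k (1 - u)) else selectionValue k y

theorem measurable_bellmanGain {R : ℝ → ℝ → Prop}
    (hR : MeasurableSet {p : ℝ × ℝ | R p.1 p.2}) (k : ℕ) :
    Measurable fun p : ℝ × ℝ => bellmanGain R k p.1 p.2 := by
  have hv := (continuous_selectionValue k).measurable
  exact Measurable.ite hR (by fun_prop) (by fun_prop)

theorem exists_bound_selectionValue (k : ℕ) :
    ∃ B, ∀ y ∈ Set.Icc (0 : ℝ) 1, |selectionValue k y| ≤ B :=
  isCompact_Icc.exists_bound_of_continuousOn (continuous_selectionValue k).continuousOn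

theorem exists_bound_bellmanGain (R : ℝ → ℝ → Prop) (k : ℕ) :
    ∃ B, ∀ y ∈ Set.Icc (0 : ℝ) 1, ∀ u ∈ Set.Icc (0 : ℝ) 1, |bellmanGain R k y u| ≤ B := by
  obtain ⟨B, hB⟩ := exists_bound_selectionValue k
  refine ⟨1 + B, fun y hy u hu => ?_⟩
  have h1 := abs_le.1 (hB y hy)
  have h2 := abs_le.1 (hB (1 - u) ⟨by linarith [hu.2], by linarith [hu.1]⟩)
  unfold bellmanGain
  split_ifs
  · exact abs_le.2 ⟨le_max_of_le_left (by linarith), max_le (by linarith) (by linarith)⟩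
  · exact abs_le.2 ⟨by linarith, by linarith⟩

theorem integral_bellmanGain {R : ℝ → ℝ → Prop} (hlt : ∀ y u, y < u → R y u)
    (hgt : ∀ y u, u < y → ¬ R y u) (k : ℕ) {y : ℝ} (hy : y ∈ Set.Icc (0 : ℝ) 1) :
    ∫ u in (0 : ℝ)..1, bellmanGain R k y u = selectionValue (k + 1) y := by
  have h0 : Set.EqOn (bellmanGain R k y) (fun _ => selectionValue k y) (Set.uIoo 0 y) := by
    intro u hu
    rw [Set.uIoo_of_le hy.1] at hu
    exact if_neg (hgt y u hu.2)
  have h1 : Set.EqOn (bellmanGain R k y)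
      (fun u => max (selectionValue k y) (1 + selectionValue k (1 - u))) (Set.uIoo y 1) := by
    intro u hu
    rw [Set.uIoo_of_le hy.2] at hu
    exact if_pos (hlt y u hu.1)
  rw [← intervalIntegral.integral_add_adjacent_intervals (b := y),
    intervalIntegral.integral_congr_uIoo h0, intervalIntegral.integral_congr_uIoo h1,
    selectionValue]
  · simp
  · exact (intervalIntegrable_const (c := selectionValue k y)).congr_uIoo h0.symm
  · exact (intervalIntegrable_bellman k y y 1).congr_uIoo h1.symm

/-! ### Selection processes -/

open Classical in
/-- The number of selections made before time `i`, and the level which the next oriented rank has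
to exceed. `D i ω s` says that the observation at time `i` is selected in the state `s`, and `F`
turns values into ranks. -/
noncomputable def gameState {Ω : Type*} (X : ℕ → Ω → ℝ) (F : ℝ → ℝ)
    (D : ℕ → Ω → ℕ × ℝ → Prop) : ℕ → Ω → ℕ × ℝ
  | 0, _ => (0, 0)
  | i + 1, ω =>
    if D i ω (gameState X F D i ω) then
      ((gameState X F D i ω).1 + 1, 1 - orient (gameState X F D i ω).1 (F (X i ω)))
    else gameState X F D i ω

section GameState

variable {Ω : Type*} {X : ℕ → Ω → ℝ} {F : ℝ → ℝ} {D : ℕ → Ω → ℕ × ℝ → Prop}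

theorem gameState_succ_of_pos {i : ℕ} {ω : Ω} (h : D i ω (gameState X F D i ω)) :
    gameState X F D (i + 1) ω =
      ((gameState X F D i ω).1 + 1, 1 - orient (gameState X F D i ω).1 (F (X i ω))) := by
  rw [gameState, if_pos h]

theorem gameState_succ_of_neg {i : ℕ} {ω : Ω} (h : ¬ D i ω (gameState X F D i ω)) :
    gameState X F D (i + 1) ω = gameState X F D i ω := by
  rw [gameState, if_neg h]

theorem gameState_fst_mono (ω : Ω) : Monotone fun i => (gameState X F D i ω).1 := by
  refine monotone_nat_of_le_succ fun i => ?_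
  by_cases h : D i ω (gameState X F D i ω)
  · simp [gameState_succ_of_pos h]
  · simp [gameState_succ_of_neg h]

theorem gameState_fst_le (i : ℕ) (ω : Ω) : (gameState X F D i ω).1 ≤ i := by
  induction i with
  | zero => simp [gameState]
  | succ i ih =>
    by_cases h : D i ω (gameState X F D i ω)
    · simpa [gameState_succ_of_pos h] using ih
    · rw [gameState_succ_of_neg h]
      omega

theorem gameState_snd_mem (hF : ∀ x, F x ∈ Set.Icc (0 : ℝ) 1) (i : ℕ) (ω : Ω) :
    (gameState X F D i ω).2 ∈ Set.Icc (0 : ℝ) 1 := by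
  induction i with
  | zero => simp [gameState]
  | succ i ih =>
    by_cases h : D i ω (gameState X F D i ω)
    · rw [gameState_succ_of_pos h]
      have := orient_mem (gameState X F D i ω).1 (hF (X i ω))
      exact ⟨by linarith [this.2], by linarith [this.1]⟩
    · rwa [gameState_succ_of_neg h]

/-- The state only depends on the past if the decisions are taken on-line. -/
theorem measurable_gameState (hF : Measurable F)
    (hD : ∀ i, Measurable[pastSigma X i] (gameState X F D i) →
      MeasurableSet[pastSigma X (i + 1)] {ω | D i ω (gameState X F D i ω)}) (i : ℕ) :
    Measurable[pastSigma X i] (gameState X F D i) := by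
  induction i with
  | zero => exact measurable_const
  | succ i ih =>
    have hs : Measurable[pastSigma X (i + 1)] (gameState X F D i) :=
      ih.mono (pastSigma_mono (Nat.le_succ i)) le_rfl
    have ho : Measurable fun q : ℕ × ℝ => orient q.1 q.2 :=
      measurable_from_prod_countable_right measurable_orient
    have hx := hF.comp (measurable_pastSigma_succ (X := X) i)
    have hu := ho.comp ((measurable_fst.comp hs).prodMk hx)
    have hsel := ((measurable_fst.comp hs).add_const 1).prodMk (hu.const_sub 1)
    exact Measurable.ite (hD i ih) hsel hs

variable [mΩ : MeasurableSpace Ω] {P : Measure Ω}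

theorem integrable_gameState_fst [IsProbabilityMeasure P] (i : ℕ)
    (hS : Measurable (gameState X F D i)) :
    Integrable (fun ω => ((gameState X F D i ω).1 : ℝ)) P := by
  refine Integrable.of_bound
    (measurable_from_nat.comp (measurable_fst.comp hS)).aestronglyMeasurable i
    (ae_of_all _ fun ω => ?_)
  simpa using gameState_fst_le i ω

theorem integrable_selectionValue_gameState [IsProbabilityMeasure P] (k i : ℕ)
    (hF : ∀ x, F x ∈ Set.Icc (0 : ℝ) 1) (hS : Measurable (gameState X F D i)) :
    Integrable (fun ω => selectionValue k (gameState X F D i ω).2) P := by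
  obtain ⟨B, hB⟩ := exists_bound_selectionValue k
  exact Integrable.of_bound
    ((continuous_selectionValue k).measurable.comp (measurable_snd.comp hS)).aestronglyMeasurable
    B (ae_of_all _ fun ω => hB _ (gameState_snd_mem hF i ω))

/-- The expected number of selections before time `i`, plus the value of the position reached
when `k` observations are left. -/
noncomputable def expectedPotential (P : Measure Ω) (X : ℕ → Ω → ℝ) (D : ℕ → Ω → ℕ × ℝ → Prop)
    (k i : ℕ) : ℝ :=
  ∫ ω, (((gameState X (cdf (P.map (X 0))) D i ω).1 : ℝ) +
    selectionValue k (gameState X (cdf (P.map (X 0))) D i ω).2) ∂P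

/-- The expected potential before an observation is the expectation of the best continuation
once that observation has been seen. -/
theorem expectedPotential_eq_integral_bellmanGain [IsProbabilityMeasure P]
    (hX : ∀ i, Measurable (X i)) (hind : iIndepFun X P)
    (hid : ∀ i, IdentDistrib (X i) (X 0) P P) (hna : NullSingletonClass (P.map (X 0)))
    (hS : ∀ i, Measurable[pastSigma X i] (gameState X (cdf (P.map (X 0))) D i))
    {R : ℝ → ℝ → Prop} (hR : MeasurableSet {p : ℝ × ℝ | R p.1 p.2})
    (hlt : ∀ y u, y < u → R y u) (hgt : ∀ y u, u < y → ¬ R y u) (k i : ℕ) :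
    Integrable (fun ω => ((gameState X (cdf (P.map (X 0))) D i ω).1 : ℝ) +
      bellmanGain R k (gameState X (cdf (P.map (X 0))) D i ω).2
        (orient (gameState X (cdf (P.map (X 0))) D i ω).1 (cdf (P.map (X 0)) (X i ω)))) P ∧
    expectedPotential P X D (k + 1) i =
      ∫ ω, (((gameState X (cdf (P.map (X 0))) D i ω).1 : ℝ) +
        bellmanGain R k (gameState X (cdf (P.map (X 0))) D i ω).2
          (orient (gameState X (cdf (P.map (X 0))) D i ω).1 (cdf (P.map (X 0)) (X i ω)))) ∂P := by
  have hF := cdf_mem_Icc (P.map (X 0))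
  have hSm := (hS i).mono (pastSigma_le hX i) le_rfl
  obtain ⟨B, hB⟩ := exists_bound_bellmanGain R k
  have hN := integrable_gameState_fst (P := P) i hSm
  obtain ⟨hint, heq⟩ := integral_orient_of_past hX hind hid hna i (hS i)
    (gameState_snd_mem hF i) (measurable_bellmanGain hR k) hB
  refine ⟨hN.add hint, ?_⟩
  rw [expectedPotential, integral_add hN (integrable_selectionValue_gameState _ i hF hSm),
    integral_add hN hint, heq]
  congr 1
  exact integral_congr_ae (ae_of_all _ fun ω =>
    (integral_bellmanGain hlt hgt k (gameState_snd_mem hF i ω)).symm)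

theorem expectedPotential_zero_right [IsProbabilityMeasure P] (k : ℕ) :
    expectedPotential P X D k 0 = selectionValue k 0 := by
  simp [expectedPotential, gameState]

theorem expectedPotential_zero_left (i : ℕ) :
    expectedPotential P X D 0 i =
      ∫ ω, ((gameState X (cdf (P.map (X 0))) D i ω).1 : ℝ) ∂P := by
  simp [expectedPotential, selectionValue]

/-- No on-line selection rule that respects the levels does better than the value function. -/
theorem integral_gameState_le [IsProbabilityMeasure P]
    (hX : ∀ i, Measurable (X i)) (hind : iIndepFun X P)
    (hid : ∀ i, IdentDistrib (X i) (X 0) P P) (hna : NullSingletonClass (P.map (X 0)))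
    (hS : ∀ i, Measurable[pastSigma X i] (gameState X (cdf (P.map (X 0))) D i))
    (hfeas : ∀ i ω, D i ω (gameState X (cdf (P.map (X 0))) D i ω) →
      (gameState X (cdf (P.map (X 0))) D i ω).2 ≤
        orient (gameState X (cdf (P.map (X 0))) D i ω).1 (cdf (P.map (X 0)) (X i ω))) (n : ℕ) :
    ∫ ω, ((gameState X (cdf (P.map (X 0))) D n ω).1 : ℝ) ∂P ≤ selectionValue n 0 := by
  have hstep : ∀ k i, expectedPotential P X D k (i + 1) ≤ expectedPotential P X D (k + 1) i := by
    intro k i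
    obtain ⟨hint, heq⟩ := expectedPotential_eq_integral_bellmanGain hX hind hid hna hS
      (R := fun y u => y ≤ u) (measurableSet_le measurable_fst measurable_snd)
      (fun _ _ h => h.le) (fun _ _ h => not_le.2 h) k i
    have hSm := (hS (i + 1)).mono (pastSigma_le hX (i + 1)) le_rfl
    rw [heq]
    refine integral_mono ((integrable_gameState_fst _ hSm).add
      (integrable_selectionValue_gameState k _ (cdf_mem_Icc _) hSm)) hint fun ω => ?_
    by_cases h : D i ω (gameState X (cdf (P.map (X 0))) D i ω)
    · simp only [gameState_succ_of_pos h, bellmanGain, if_pos (hfeas i ω h)]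
      push_cast
      linarith [le_max_right
        (selectionValue k (gameState X (cdf (P.map (X 0))) D i ω).2)
        (1 + selectionValue k
          (1 - orient (gameState X (cdf (P.map (X 0))) D i ω).1 (cdf (P.map (X 0)) (X i ω))))]
    · simp only [gameState_succ_of_neg h, bellmanGain]
      gcongr
      split_ifs
      · exact le_max_left _ _
      · exact le_rfl
  have hall : ∀ i k, expectedPotential P X D k i ≤ selectionValue (k + i) 0 := by
    intro i
    induction i with
    | zero => exact fun k => (expectedPotential_zero_right k).le
    | succ i ih =>
      intro k
      have := (hstep k i).trans (ih (k + 1))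
      rwa [add_right_comm, add_assoc] at this
  rw [← expectedPotential_zero_left]
  simpa using hall n 0

/-- A selection rule that selects whenever this is worthwhile attains the value function. -/
theorem integral_gameState_eq [IsProbabilityMeasure P]
    (hX : ∀ i, Measurable (X i)) (hind : iIndepFun X P)
    (hid : ∀ i, IdentDistrib (X i) (X 0) P P) (hna : NullSingletonClass (P.map (X 0)))
    (hS : ∀ i, Measurable[pastSigma X i] (gameState X (cdf (P.map (X 0))) D i)) (n : ℕ)
    (hopt : ∀ i ω s, D i ω s ↔ s.2 < orient s.1 (cdf (P.map (X 0)) (X i ω)) ∧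
      selectionValue (n - (i + 1)) s.2 ≤
        1 + selectionValue (n - (i + 1)) (1 - orient s.1 (cdf (P.map (X 0)) (X i ω)))) :
    ∫ ω, ((gameState X (cdf (P.map (X 0))) D n ω).1 : ℝ) ∂P = selectionValue n 0 := by
  have hstep : ∀ k i, k + i + 1 = n →
      expectedPotential P X D k (i + 1) = expectedPotential P X D (k + 1) i := by
    intro k i hki
    rw [(expectedPotential_eq_integral_bellmanGain hX hind hid hna hS
      (R := fun y u => y < u) (measurableSet_lt measurable_fst measurable_snd)
      (fun _ _ h => h) (fun _ _ h => not_lt.2 h.le) k i).2]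
    refine integral_congr_ae (ae_of_all _ fun ω => ?_)
    have hk : n - (i + 1) = k := by omega
    have ho := hopt i ω (gameState X (cdf (P.map (X 0))) D i ω)
    rw [hk] at ho
    by_cases h : D i ω (gameState X (cdf (P.map (X 0))) D i ω)
    · simp only [gameState_succ_of_pos h, bellmanGain, if_pos (ho.1 h).1,
        max_eq_right (ho.1 h).2]
      push_cast
      ring
    · simp only [gameState_succ_of_neg h, bellmanGain]
      congr 1
      split_ifs with hlt
      · have hnot := fun hle => h (ho.2 ⟨hlt, hle⟩)
        exact (max_eq_left (not_le.1 hnot).le).symm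
      · rfl
  have hall : ∀ i k, k + i = n → expectedPotential P X D k i = selectionValue n 0 := by
    intro i
    induction i with
    | zero =>
      rintro k rfl
      exact expectedPotential_zero_right k
    | succ i ih => exact fun k hk => (hstep k i hk).trans (ih (k + 1) (by omega))
  rw [← expectedPotential_zero_left]
  exact hall n 0 (zero_add n)

end GameState

theorem withTop_lt_succ_iff (t : WithTop ℕ) (i : ℕ) :
    t < ((i + 1 : ℕ) : WithTop ℕ) ↔ t ≤ (i : WithTop ℕ) := by
  cases t with
  | top => simp
  | coe m => exact WithTop.coe_lt_coe.trans (Nat.lt_succ_iff.trans WithTop.coe_le_coe.symm)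

/-! ### Every policy is a selection process -/

namespace SelectionPolicy

variable {Ω : Type*} [mΩ : MeasurableSpace Ω] {X : ℕ → Ω → ℝ} {hX : ∀ i, Measurable (X i)}

/-- The decisions of a policy: in a state with `k` previous selections, the observation at time `i`
is selected if it is the one at the selection time `τ k`. -/
def decision (π : SelectionPolicy X hX) (i : ℕ) (ω : Ω) (s : ℕ × ℝ) : Prop := π.τ s.1 ω = i

theorem lt_gameState_iff (π : SelectionPolicy X hX) (F : ℝ → ℝ) (i k : ℕ) (ω : Ω) :
    k < (gameState X F π.decision i ω).1 ↔ π.τ k ω < i := by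
  induction i generalizing k with
  | zero => simp [gameState]
  | succ i ih =>
    rw [withTop_lt_succ_iff, le_iff_lt_or_eq, ← ih]
    set s := gameState X F π.decision i ω with hs
    by_cases h : π.decision i ω s
    · rw [gameState_succ_of_pos h, ← hs, Nat.lt_succ_iff, le_iff_lt_or_eq]
      refine or_congr_right' fun hk => ⟨fun hks => hks ▸ h, fun hk' => ?_⟩
      -- Only one selection is made at time `i`.
      by_contra hne
      have hlt : s.1 < k := by omega
      have hk0 : k - 1 + 1 = k := by omega
      have hinc := π.strictly_increasing (k - 1) ω (by rw [hk0, hk']; exact WithTop.coe_ne_top)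
      rw [hk0, hk', ← ih] at hinc
      have hk1 : k - 1 = s.1 := by omega
      omega
    · rw [gameState_succ_of_neg h, ← hs]
      refine ⟨Or.inl, fun hor => hor.elim id fun hk => ?_⟩
      by_contra hnot
      rcases (not_lt.1 hnot).eq_or_lt with heq | hlt
      · exact h (show π.τ s.1 ω = i from heq ▸ hk)
      · have hk0 : k - 1 + 1 = k := by omega
        have hinc := π.strictly_increasing (k - 1) ω (by rw [hk0, hk]; exact WithTop.coe_ne_top)
        rw [hk0, hk, ← ih] at hinc
        omega

theorem numSelected_eq_of_forall_lt_iff (π : SelectionPolicy X hX) {n m : ℕ} {ω : Ω}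
    (h : ∀ k, k < m ↔ π.τ k ω < n) : π.numSelected n ω = m := by
  have hset : {k : ℕ | π.τ k ω < n} = (Finset.range m : Set ℕ) := by
    ext k
    simp [h]
  rw [numSelected, hset, Set.ncard_coe_finset, Finset.card_range]

theorem numSelected_eq_gameState (π : SelectionPolicy X hX) (F : ℝ → ℝ) (n : ℕ) (ω : Ω) :
    π.numSelected n ω = (gameState X F π.decision n ω).1 :=
  π.numSelected_eq_of_forall_lt_iff fun k => π.lt_gameState_iff F n k ω

theorem gameState_snd_eq (π : SelectionPolicy X hX) (F : ℝ → ℝ) (i : ℕ) (ω : Ω) :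
    ((gameState X F π.decision i ω).1 = 0 → (gameState X F π.decision i ω).2 = 0) ∧
    ∀ k j : ℕ, (gameState X F π.decision i ω).1 = k + 1 → π.τ k ω = j →
      (gameState X F π.decision i ω).2 = 1 - orient k (F (X j ω)) := by
  induction i with
  | zero => simp [gameState]
  | succ i ih =>
    by_cases h : π.decision i ω (gameState X F π.decision i ω)
    · rw [gameState_succ_of_pos h]
      refine ⟨by simp, fun k j hk hj => ?_⟩
      obtain rfl : (gameState X F π.decision i ω).1 = k := by simpa using hk
      have hij : i = j := WithTop.coe_injective (h.symm.trans hj)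
      rw [hij]
    · rwa [gameState_succ_of_neg h]

/-- The alternation of the selected values forces the oriented rank of a selected observation to
reach the current level. -/
theorem level_le_of_decision (π : SelectionPolicy X hX) {F : ℝ → ℝ} (hF : Monotone F)
    (hFI : ∀ x, F x ∈ Set.Icc (0 : ℝ) 1) (i : ℕ) (ω : Ω)
    (h : π.decision i ω (gameState X F π.decision i ω)) :
    (gameState X F π.decision i ω).2 ≤
      orient (gameState X F π.decision i ω).1 (F (X i ω)) := by
  obtain ⟨h0, h1⟩ := π.gameState_snd_eq F i ω
  have hlt := π.lt_gameState_iff F i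
  have hs : π.τ (gameState X F π.decision i ω).1 ω = i := h
  cases hk : (gameState X F π.decision i ω).1 with
  | zero =>
    rw [h0 hk]
    exact (orient_mem _ (hFI _)).1
  | succ k =>
    rw [hk] at hs
    have hτ : π.τ k ω < i := (hlt k ω).1 (by omega)
    obtain ⟨j, hj⟩ := WithTop.ne_top_iff_exists.1 (ne_top_of_lt hτ)
    rw [h1 k j hk hj.symm]
    have halt := π.alternating k ω j i hj.symm hs
    unfold orient
    by_cases he : Even k
    · rw [if_pos he] at halt
      rw [if_pos he, if_neg (by simpa [Nat.even_add_one] using he)]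
      linarith [hF halt.le]
    · rw [if_neg he] at halt
      rw [if_neg he, if_pos (by simpa [Nat.even_add_one] using he)]
      linarith [hF halt.le]

theorem measurable_gameState_decision (π : SelectionPolicy X hX) {F : ℝ → ℝ} (hF : Measurable F)
    (i : ℕ) : Measurable[pastSigma X i] (gameState X F π.decision i) := by
  refine measurable_gameState hF (fun i hi => ?_) i
  have hset : {ω | π.decision i ω (gameState X F π.decision i ω)} =
      ⋃ k : ℕ, {ω | (gameState X F π.decision i ω).1 = k} ∩ {ω | π.τ k ω = i} := by
    ext ω
    simp [decision]
  rw [hset]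
  refine MeasurableSet.iUnion fun k => MeasurableSet.inter ?_ ?_
  · exact pastSigma_mono (Nat.le_succ i) _ (measurable_fst.comp hi (measurableSet_singleton k))
  · rw [pastSigma_succ hX]
    exact (π.isStoppingTime k).measurableSet_eq i

theorem expectedSelected_le {P : Measure Ω} [IsProbabilityMeasure P] (π : SelectionPolicy X hX)
    (hind : iIndepFun X P) (hid : ∀ i, IdentDistrib (X i) (X 0) P P)
    (hna : NullSingletonClass (P.map (X 0))) (n : ℕ) :
    π.expectedSelected P n ≤ selectionValue n 0 := by
  have hF := cdf_mem_Icc (P.map (X 0))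
  have hmono := monotone_cdf (P.map (X 0))
  simp_rw [expectedSelected, π.numSelected_eq_gameState (cdf (P.map (X 0)))]
  exact integral_gameState_le hX hind hid hna
    (π.measurable_gameState_decision hmono.measurable)
    (π.level_le_of_decision hmono hF) n

end SelectionPolicy

/-! ### The optimal policy -/

section Greedy

variable {Ω : Type*}

/-- The decisions of the optimal policy for `n` observations: an available observation is selected
if the value of the position reached makes up for it. Past the horizon the truncated subtraction
gives `selectionValue 0`, so that every available observation is selected. -/
def greedyDecision (X : ℕ → Ω → ℝ) (F : ℝ → ℝ) (n i : ℕ) (ω : Ω) (s : ℕ × ℝ) : Prop :=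
  s.2 < orient s.1 (F (X i ω)) ∧
    selectionValue (n - (i + 1)) s.2 ≤
      1 + selectionValue (n - (i + 1)) (1 - orient s.1 (F (X i ω)))

variable {X : ℕ → Ω → ℝ} {F : ℝ → ℝ}

theorem measurable_gameState_greedy (hF : Measurable F) (n i : ℕ) :
    Measurable[pastSigma X i] (gameState X F (greedyDecision X F n) i) := by
  refine measurable_gameState hF (fun i hi => ?_) i
  have hs := hi.mono (pastSigma_mono (Nat.le_succ i)) le_rfl
  have ho : Measurable fun q : ℕ × ℝ => orient q.1 q.2 :=
    measurable_from_prod_countable_right measurable_orient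
  have hu := ho.comp ((measurable_fst.comp hs).prodMk
    (hF.comp (measurable_pastSigma_succ (X := X) i)))
  have hv := (continuous_selectionValue (n - (i + 1))).measurable
  have hs2 := measurable_snd.comp hs
  exact (measurableSet_lt hs2 hu).inter
    (measurableSet_le (hv.comp hs2) ((hv.comp (hu.const_sub 1)).const_add 1))

open Classical in
/-- The time of the `(k + 1)`-st selection of a selection process. -/
noncomputable def selectionTime (X : ℕ → Ω → ℝ) (F : ℝ → ℝ) (D : ℕ → Ω → ℕ × ℝ → Prop)
    (k : ℕ) (ω : Ω) : WithTop ℕ :=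
  if h : ∃ i, k < (gameState X F D (i + 1) ω).1 then (Nat.find h : ℕ) else ⊤

variable {D : ℕ → Ω → ℕ × ℝ → Prop}

theorem selectionTime_le_iff (k i : ℕ) (ω : Ω) :
    selectionTime X F D k ω ≤ i ↔ k < (gameState X F D (i + 1) ω).1 := by
  classical
  unfold selectionTime
  split_ifs with h
  · refine WithTop.coe_le_coe.trans ⟨fun hle => ?_, fun hlt => Nat.find_min' h hlt⟩
    exact (Nat.find_spec h).trans_le (gameState_fst_mono ω (Nat.succ_le_succ hle))
  · simpa using not_exists.1 h i

theorem selectionTime_lt_iff (k i : ℕ) (ω : Ω) :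
    selectionTime X F D k ω < i ↔ k < (gameState X F D i ω).1 := by
  cases i with
  | zero => simp [gameState]
  | succ i => rw [withTop_lt_succ_iff, selectionTime_le_iff]

/-- At the time of the `(k + 1)`-st selection, `k` selections have been made before, and the
observation is selected. -/
theorem of_selectionTime_eq {k i : ℕ} {ω : Ω} (h : selectionTime X F D k ω = i) :
    (gameState X F D i ω).1 = k ∧ D i ω (gameState X F D i ω) := by
  have h1 := (selectionTime_le_iff k i ω).1 h.le
  have h2 : ¬ k < (gameState X F D i ω).1 := fun hlt =>
    ((selectionTime_lt_iff k i ω).2 hlt).ne h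
  by_cases hD : D i ω (gameState X F D i ω)
  · rw [gameState_succ_of_pos hD] at h1
    exact ⟨by simp only at h1; omega, hD⟩
  · rw [gameState_succ_of_neg hD] at h1
    exact absurd h1 h2

theorem gameState_eq_of_fst_eq {i j : ℕ} {ω : Ω} (hij : i ≤ j)
    (h : (gameState X F D j ω).1 = (gameState X F D i ω).1) :
    gameState X F D j ω = gameState X F D i ω := by
  induction j, hij using Nat.le_induction with
  | base => rfl
  | succ j hij ih =>
    by_cases hD : D j ω (gameState X F D j ω)
    · have hm : (gameState X F D i ω).1 ≤ (gameState X F D j ω).1 := gameState_fst_mono ω hij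
      rw [gameState_succ_of_pos hD] at h
      simp only at h
      omega
    · rw [gameState_succ_of_neg hD] at h ⊢
      exact ih h

theorem selectionTime_strictly_increasing (k : ℕ) (ω : Ω)
    (h : selectionTime X F D (k + 1) ω ≠ ⊤) :
    selectionTime X F D k ω < selectionTime X F D (k + 1) ω := by
  obtain ⟨j, hj⟩ := WithTop.ne_top_iff_exists.1 h
  rw [← hj]
  exact (selectionTime_lt_iff k j ω).2 (by rw [(of_selectionTime_eq hj.symm).1]; omega)

theorem alternating_selectionTime (hF : Monotone F)
    (hD : ∀ i ω s, D i ω s → s.2 < orient s.1 (F (X i ω))) {k i j : ℕ} {ω : Ω}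
    (hi : selectionTime X F D k ω = i) (hj : selectionTime X F D (k + 1) ω = j) :
    if Even k then X i ω < X j ω else X i ω > X j ω := by
  obtain ⟨hik, hiD⟩ := of_selectionTime_eq hi
  obtain ⟨hjk, hjD⟩ := of_selectionTime_eq hj
  have hij : i < j := by
    have := selectionTime_strictly_increasing (X := X) (F := F) (D := D) k ω (by simp [hj])
    rw [hi, hj] at this
    exact WithTop.coe_lt_coe.1 this
  have hsucc := gameState_succ_of_pos hiD
  have hstate := gameState_eq_of_fst_eq (X := X) (F := F) (D := D) (ω := ω)
    (Nat.succ_le_of_lt hij) (by rw [hjk, Nat.succ_eq_add_one, hsucc, hik])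
  have hlt := hD _ _ _ hjD
  rw [hjk, hstate, Nat.succ_eq_add_one, hsucc, hik] at hlt
  unfold orient at hlt
  by_cases he : Even k
  · rw [if_pos he, if_neg (by simpa [Nat.even_add_one] using he)] at hlt
    rw [if_pos he]
    exact hF.reflect_lt (by simpa using hlt)
  · rw [if_neg he, if_pos (by simpa [Nat.even_add_one] using he)] at hlt
    rw [if_neg he]
    exact hF.reflect_lt (by simpa using hlt)

variable [mΩ : MeasurableSpace Ω]

/-- The policy that selects an observation whenever this is feasible and worthwhile. -/
noncomputable def greedyPolicy (hX : ∀ i, Measurable (X i)) (hF : Monotone F) (n : ℕ) :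
    SelectionPolicy X hX where
  τ := selectionTime X F (greedyDecision X F n)
  isStoppingTime k i := by
    have h : MeasurableSet[observationFiltration X hX i]
        {ω | k < (gameState X F (greedyDecision X F n) (i + 1) ω).1} := by
      rw [← pastSigma_succ hX]
      exact measurable_fst.comp (measurable_gameState_greedy hF.measurable n (i + 1))
        measurableSet_Ioi
    convert h using 1
    ext ω
    exact selectionTime_le_iff k i ω
  strictly_increasing k ω h := selectionTime_strictly_increasing k ω h
  alternating _ _ _ _ hi hj := alternating_selectionTime hF (fun _ _ _ h => h.1) hi hj

theorem expectedSelected_greedyPolicy {P : Measure Ω} [IsProbabilityMeasure P]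
    (hX : ∀ i, Measurable (X i)) (hind : iIndepFun X P)
    (hid : ∀ i, IdentDistrib (X i) (X 0) P P) (hna : NullSingletonClass (P.map (X 0))) (n : ℕ) :
    (greedyPolicy hX (monotone_cdf (P.map (X 0))) n).expectedSelected P n =
      selectionValue n 0 := by
  have hnum : ∀ ω, (greedyPolicy hX (monotone_cdf (P.map (X 0))) n).numSelected n ω =
      (gameState X (cdf (P.map (X 0))) (greedyDecision X (cdf (P.map (X 0))) n) n ω).1 :=
    fun ω => SelectionPolicy.numSelected_eq_of_forall_lt_iff _ fun k =>
      (selectionTime_lt_iff k n ω).symm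
  simp_rw [SelectionPolicy.expectedSelected, hnum]
  exact integral_gameState_eq hX hind hid hna
    (measurable_gameState_greedy (monotone_cdf (P.map (X 0))).measurable n) n
    fun _ _ _ => Iff.rfl

end Greedy

/-! ### The optimal expected number of selections -/

theorem isOptimal_iff_expectedSelected_eq {Ω : Type*} [MeasurableSpace Ω] {P : Measure Ω}
    [IsProbabilityMeasure P] {X : ℕ → Ω → ℝ} {hX : ∀ i, Measurable (X i)}
    (hind : iIndepFun X P) (hid : ∀ i, IdentDistrib (X i) (X 0) P P)
    (hna : NullSingletonClass (P.map (X 0))) {n : ℕ} {π : SelectionPolicy X hX} :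
    π.IsOptimal P n ↔ π.expectedSelected P n = selectionValue n 0 := by
  have hgreedy := expectedSelected_greedyPolicy hX hind hid hna n
  refine ⟨fun h => ?_, fun h => ⟨⟨π, rfl⟩, ?_⟩⟩
  · exact le_antisymm (π.expectedSelected_le hind hid hna n) (hgreedy ▸ h.2 ⟨_, rfl⟩)
  · rintro _ ⟨π', rfl⟩
    exact (π'.expectedSelected_le hind hid hna n).trans h.ge

theorem selectionValue_zero_bounds (n : ℕ) :
    (2 - Real.sqrt 2) * n ≤ selectionValue n 0 ∧
      selectionValue n 0 ≤ (2 - Real.sqrt 2) * n + 1 := by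
  have hpos := limitThreshold_pos
  have hhalf := limitThreshold_lt_half
  have h0 : relativeValue 0 = 0 := relativeValue_of_le hpos.le
  have hl := le_selectionValue n (y := 0) ⟨le_rfl, by linarith⟩
  have hu := selectionValue_le n (y := 0) ⟨le_rfl, zero_le_one⟩
  rw [h0, two_mul_limitThreshold] at hl hu
  exact ⟨by linarith, by linarith⟩

theorem isEquivalent_of_bounded_sub {a : ℕ → ℝ} {c C : ℝ} (hc : 0 < c)
    (h : ∀ n : ℕ, 1 ≤ n → c * n ≤ a n ∧ a n ≤ c * n + C) :
    a ~[atTop] fun n : ℕ => c * n := by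
  have hO : (fun n : ℕ => a n - c * n) =O[atTop] fun _ => (1 : ℝ) := by
    refine IsBigO.of_bound C (eventually_atTop.2 ⟨1, fun n hn => ?_⟩)
    obtain ⟨h1, h2⟩ := h n hn
    rw [Real.norm_of_nonneg (by linarith), norm_one]
    linarith
  have ho : (fun _ : ℕ => (1 : ℝ)) =o[atTop] fun n : ℕ => c * n := by
    rw [isLittleO_const_left]
    exact Or.inr (tendsto_norm_atTop_atTop.comp
      (tendsto_natCast_atTop_atTop.const_mul_atTop hc))
  exact hO.trans_isLittleO ho

theorem theorem1 :
    ∃ C : ℝ, C < 11 - 4 * Real.sqrt 2 ∧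
      ∀ (Ω : Type*) [MeasurableSpace Ω] (P : Measure Ω) [IsProbabilityMeasure P]
        (X : ℕ → Ω → ℝ) (hX : ∀ i, Measurable (X i)),
        iIndepFun X P → (∀ i, IdentDistrib (X i) (X 0) P P) → NullSingletonClass (P.map (X 0)) →
        (∀ n : ℕ, 1 ≤ n → ∃ π : SelectionPolicy X hX, π.IsOptimal P n) ∧
        (∀ n : ℕ, 1 ≤ n → ∀ π : SelectionPolicy X hX, π.IsOptimal P n →
          (2 - Real.sqrt 2) * n ≤ π.expectedSelected P n ∧
          π.expectedSelected P n ≤ (2 - Real.sqrt 2) * n + C) ∧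
        (∀ π : ℕ → SelectionPolicy X hX, (∀ n : ℕ, 1 ≤ n → (π n).IsOptimal P n) →
          (fun n : ℕ => (π n).expectedSelected P n)
            ~[atTop] fun n : ℕ => (2 - Real.sqrt 2) * n) := by
  have hsqrt : Real.sqrt 2 < 2 := by rw [Real.sqrt_lt' (by norm_num)]; norm_num
  refine ⟨1, by linarith, fun Ω _ P _ X hX hind hid hna => ?_⟩
  have hiff := fun (n : ℕ) (π : SelectionPolicy X hX) =>
    isOptimal_iff_expectedSelected_eq (n := n) (π := π) hind hid hna
  have hbounds : ∀ n : ℕ, 1 ≤ n → ∀ π : SelectionPolicy X hX, π.IsOptimal P n →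
      (2 - Real.sqrt 2) * n ≤ π.expectedSelected P n ∧
      π.expectedSelected P n ≤ (2 - Real.sqrt 2) * n + 1 := by
    intro n _ π hπ
    rw [(hiff n π).1 hπ]
    exact selectionValue_zero_bounds n
  refine ⟨fun n _ => ⟨_, (hiff n _).2 (expectedSelected_greedyPolicy hX hind hid hna n)⟩,
    hbounds, fun π hπ => ?_⟩
  exact isEquivalent_of_bounded_sub (by linarith) fun n hn => hbounds n hn _ (hπ n hn)
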